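/- Let $X$ be a compact metrisable space on which an abelian group $T$ acts by homeomorphisms, and suppose that the system $(X,T)$ is minimal (every orbit is dense, $X\neq\emptyset$). Let $d$ be a metric inducing the topology of $X$; two points $x,y\in X$ are called proximal if $\inf_{t\in T}d(tx,ty)=0$. Let $\pi:X\to X_{max}$ be the maximal equicontinuous factor of $(X,T)$; since $T$ is abelian, $X_{max}$ is a compact abelian topological group (written additively, the neutral element being an arbitrarily chosen point) on which $T$ acts by translations. A point $\xi\in X_{max}$ is called singular if the fibre $\pi^{-1}(\xi)$ contains two distinct proximal points. Let $\mathcal L^{sing}\subset X_{max}$ be the subgroup generated by all differences $\xi-\xi'$ of singular points $\xi,\xi'$. Let $E$ be the Ellis semigroup of $(X,T)$, that is, the closure of the set of maps $\{x\mapsto tx : t\in T\}$ in $X^X$ for the topology of pointwise convergence, with composition as product. Its kernel $\ker E$ is its smallest two-sided ideal, the idempotents of $\ker E$ are called minimal idempotents, and for a minimal idempotent $e$ the structure group is $\mathcal H_e=eEe$. Then: (1) $\mathcal L^{sing}$ is not open in $X_{max}$ if and only if $X_{max}/\mathcal L^{sing}$ is uncountable. (2) If the proximal relation is not transitive and $\mathcal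 L^{sing}$ is not open (equivalently, by (1), $X_{max}/\mathcal L^{sing}$ is uncountable), then for every minimal idempotent $e$ the structure group $\mathcal H_e$ has cardinality $2^{\mathfrak c}$, where $\mathfrak c$ is the cardinality of the continuum. -/

import Mathlib

open Set Topology

universe v u

namespace TopDyn

section Equicontinuous

/-- The equicontinuous structure relation: `x ∼ y` iff `x` and `y` are identified by every
equicontinuous factor `φ : X → Z` of the system `(X, T)`.  Here `Z` is a compact Hausdorff space
(with its unique compatible uniformity) on which `T` acts equicontinuously. -/
def eqStructureRel (T : Type v) (X : Type u) [AddCommGroup T] [TopologicalSpace X]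
    [AddAction T X] : Setoid X where
  r x y := ∀ (Z : Type u) [UniformSpace Z] [CompactSpace Z] [T2Space Z] [AddAction T Z]
    (φ : X → Z), Equicontinuous (fun (t : T) (z : Z) => t +ᵥ z) → Continuous φ →
    Function.Surjective φ → (∀ (t : T) (x : X), φ (t +ᵥ x) = t +ᵥ φ x) → φ x = φ y
  iseqv :=
    { refl := by intros; rfl
      symm := by
        intro x y h Z _ _ _ _ φ h1 h2 h3 h4
        exact (h Z φ h1 h2 h3 h4).symm
      trans := by
        intro x y z h h' Z _ _ _ _ φ h1 h2 h3 h4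
        exact (h Z φ h1 h2 h3 h4).trans (h' Z φ h1 h2 h3 h4) }

/-- The maximal equicontinuous factor `X_max`, pointed by (the image of) `x₀`: the quotient of `X`
by the equicontinuous structure relation.  The base point does not affect the space or the action;
it is only used to select the neutral element of the group structure of `X_max`. -/
def MaxFactor (T : Type v) {X : Type u} [AddCommGroup T] [TopologicalSpace X] [AddAction T X]
    (_x₀ : X) : Type u :=
  Quotient (eqStructureRel T X)

variable (T : Type v) {X : Type u} [AddCommGroup T] [TopologicalSpace X] [AddAction T X] (x₀ : X)

/-- The factor map `π : X → X_max`. -/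
def MaxFactor.proj (x : X) : MaxFactor T x₀ := Quotient.mk (eqStructureRel T X) x

/-- `X_max` carries the quotient topology. -/
instance : TopologicalSpace (MaxFactor T x₀) :=
  inferInstanceAs (TopologicalSpace (Quotient (eqStructureRel T X)))

theorem MaxFactor.continuous_proj : Continuous (MaxFactor.proj T x₀) :=
  continuous_quotient_mk'

theorem MaxFactor.surjective_proj : Function.Surjective (MaxFactor.proj T x₀) :=
  Quotient.mk_surjective

/-- The action of `T` on `X_max` induced by `π`. -/
instance : AddAction T (MaxFactor T x₀) where
  vadd t := Quotient.map' (s₁ := eqStructureRel T X) (s₂ := eqStructureRel T X) (fun x => t +ᵥ x)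
    (by
      intro x y h Z _ _ _ _ φ h1 h2 h3 h4
      rw [h4, h4, h Z φ h1 h2 h3 h4])
  zero_vadd := by
    intro ξ
    obtain ⟨x, rfl⟩ := MaxFactor.surjective_proj T x₀ ξ
    exact congrArg (MaxFactor.proj T x₀) (zero_vadd T x)
  add_vadd := by
    intro s t ξ
    obtain ⟨x, rfl⟩ := MaxFactor.surjective_proj T x₀ ξ
    exact congrArg (MaxFactor.proj T x₀) (add_vadd s t x)

theorem MaxFactor.proj_vadd (t : T) (x : X) :
    MaxFactor.proj T x₀ (t +ᵥ x) = t +ᵥ MaxFactor.proj T x₀ x := rfl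

/-- The universal property of `X_max`: every equicontinuous factor of `X` factors through `π`. -/
theorem MaxFactor.exists_lift {Z : Type u} [UniformSpace Z] [CompactSpace Z] [T2Space Z]
    [AddAction T Z] (φ : X → Z) (h1 : Equicontinuous (fun (t : T) (z : Z) => t +ᵥ z))
    (h2 : Continuous φ) (h3 : Function.Surjective φ)
    (h4 : ∀ (t : T) (x : X), φ (t +ᵥ x) = t +ᵥ φ x) :
    ∃ ψ : MaxFactor T x₀ → Z, Continuous ψ ∧ (∀ x, ψ (MaxFactor.proj T x₀ x) = φ x) ∧
      ∀ (t : T) ξ, ψ (t +ᵥ ξ) = t +ᵥ ψ ξ := by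
  let ψ : MaxFactor T x₀ → Z :=
    Quotient.lift (s := eqStructureRel T X) φ (fun x y h => h Z φ h1 h2 h3 h4)
  refine ⟨ψ, ?_, fun x => rfl, ?_⟩
  · exact Continuous.quotient_lift h2 _
  · intro t ξ
    obtain ⟨x, rfl⟩ := MaxFactor.surjective_proj T x₀ ξ
    exact h4 t x

instance [CompactSpace X] : CompactSpace (MaxFactor T x₀) :=
  inferInstanceAs (CompactSpace (Quotient (eqStructureRel T X)))

theorem MaxFactor.exists_separating {ξ η : MaxFactor T x₀} (h : ξ ≠ η) :
    ∃ (Z : Type u) (_ : UniformSpace Z) (_ : CompactSpace Z) (_ : T2Space Z) (_ : AddAction T Z)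
      (ψ : MaxFactor T x₀ → Z), Equicontinuous (fun (t : T) (z : Z) => t +ᵥ z) ∧ Continuous ψ ∧
        (∀ (t : T) ζ, ψ (t +ᵥ ζ) = t +ᵥ ψ ζ) ∧ ψ ξ ≠ ψ η := by
  obtain ⟨x, rfl⟩ := MaxFactor.surjective_proj T x₀ ξ
  obtain ⟨y, rfl⟩ := MaxFactor.surjective_proj T x₀ η
  have h' : ¬ (eqStructureRel T X).r x y := fun hxy => h (Quotient.sound hxy)
  change ¬ ∀ (Z : Type u) [UniformSpace Z] [CompactSpace Z] [T2Space Z] [AddAction T Z]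
    (φ : X → Z), Equicontinuous (fun (t : T) (z : Z) => t +ᵥ z) → Continuous φ →
    Function.Surjective φ → (∀ (t : T) (x : X), φ (t +ᵥ x) = t +ᵥ φ x) → φ x = φ y at h'
  simp only [not_forall] at h'
  obtain ⟨Z, i1, i2, i3, i4, φ, h1, h2, h3, h4, h5⟩ := h'
  obtain ⟨ψ, k1, k2, k3⟩ := MaxFactor.exists_lift T x₀ φ h1 h2 h3 h4
  exact ⟨Z, i1, i2, i3, i4, ψ, h1, k1, k3, by rwa [k2, k2]⟩

instance : T2Space (MaxFactor T x₀) where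
  t2 := by
    intro ξ η h
    obtain ⟨Z, _, _, _, _, ψ, -, hψ, -, hne⟩ := MaxFactor.exists_separating T x₀ h
    obtain ⟨U, V, hU, hV, hx, hy, hd⟩ := t2_separation hne
    exact ⟨ψ ⁻¹' U, ψ ⁻¹' V, hU.preimage hψ, hV.preimage hψ, hx, hy, hd.preimage ψ⟩

/-- The action of `T` on `X_max` is equicontinuous. -/
theorem MaxFactor.equicontinuous [CompactSpace X] :
    letI : UniformSpace (MaxFactor T x₀) := uniformSpaceOfCompactR1
    Equicontinuous (fun (t : T) (ξ : MaxFactor T x₀) => t +ᵥ ξ) := by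
  let S : Set (UniformSpace (MaxFactor T x₀)) :=
    {w | Continuous[inferInstance, w.toTopologicalSpace] (id : MaxFactor T x₀ → MaxFactor T x₀) ∧
      Equicontinuous (uα := w) (fun (t : T) (ξ : MaxFactor T x₀) => t +ᵥ ξ)}
  have key : ∀ ξ η : MaxFactor T x₀, ξ ≠ η → ∃ w ∈ S, ∃ U V : Set (MaxFactor T x₀),
      IsOpen[w.toTopologicalSpace] U ∧ IsOpen[w.toTopologicalSpace] V ∧ ξ ∈ U ∧ η ∈ V ∧
        Disjoint U V := by
    intro ξ η h
    obtain ⟨Z, i1, _, _, _, ψ, hZ, hψ, hT, hne⟩ := MaxFactor.exists_separating T x₀ h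
    obtain ⟨U, V, hU, hV, hx, hy, hd⟩ := t2_separation hne
    refine ⟨i1.comap ψ, ⟨?_, ?_⟩, ψ ⁻¹' U, ψ ⁻¹' V, ⟨U, hU, rfl⟩, ⟨V, hV, rfl⟩, hx, hy,
      hd.preimage ψ⟩
    · exact continuous_induced_rng.2 hψ
    · intro ξ₀ W hW
      obtain ⟨W', hW', hsub⟩ := hW
      have := hψ.continuousAt.eventually (hZ (ψ ξ₀) W' hW')
      filter_upwards [this] with ζ hζ t
      apply hsub
      have := hζ t
      simpa [hT] using this
  have htop : (sInf S).toTopologicalSpace = (inferInstance : TopologicalSpace (MaxFactor T x₀)) := by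
    have hle : (inferInstance : TopologicalSpace (MaxFactor T x₀)) ≤ (sInf S).toTopologicalSpace := by
      rw [UniformSpace.toTopologicalSpace_sInf]
      exact le_iInf₂ fun w hw => continuous_id_iff_le.1 hw.1
    have hT2 : @T2Space _ (sInf S).toTopologicalSpace := by
      refine @T2Space.mk _ (sInf S).toTopologicalSpace fun ξ η h => ?_
      obtain ⟨w, hw, U, V, hU, hV, hx, hy, hd⟩ := key ξ η h
      have hw' : (sInf S).toTopologicalSpace ≤ w.toTopologicalSpace := by
        rw [UniformSpace.toTopologicalSpace_sInf]
        exact iInf₂_le w hw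
      exact ⟨U, V, hw' U hU, hw' V hV, hx, hy, hd⟩
    have hc : @Continuous _ _ inferInstance (sInf S).toTopologicalSpace
        (id : MaxFactor T x₀ → MaxFactor T x₀) := continuous_id_iff_le.2 hle
    refine le_antisymm ?_ hle
    have hcl := @Continuous.isClosedMap _ _ inferInstance (sInf S).toTopologicalSpace
      inferInstance hT2 _ hc
    intro U hU
    have := hcl Uᶜ hU.isClosed_compl
    rw [image_id] at this
    exact (@isClosed_compl_iff _ (sInf S).toTopologicalSpace U).1 this
  have heq : (uniformSpaceOfCompactR1 : UniformSpace (MaxFactor T x₀)) = sInf S :=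
    unique_uniformity_of_compact rfl htop
  have := (equicontinuous_iInf_rng (u := fun w : S => (w : UniformSpace (MaxFactor T x₀)))
    (F := fun (t : T) (ξ : MaxFactor T x₀) => t +ᵥ ξ)).2 fun w => w.2.2
  show @Equicontinuous _ _ _ _ uniformSpaceOfCompactR1 _
  rw [heq, sInf_eq_iInf']
  exact this

instance [AddAction.IsMinimal T X] : AddAction.IsMinimal T (MaxFactor T x₀) where
  dense_orbit := by
    intro ξ
    obtain ⟨x, rfl⟩ := MaxFactor.surjective_proj T x₀ ξ
    exact (MaxFactor.surjective_proj T x₀).denseRange.comp (denseRange_vadd T x)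
      (MaxFactor.continuous_proj T x₀)

/-- A minimal equicontinuous system with abelian acting group is a topological group, with any
prescribed point as neutral element, on which the acting group acts by translations. -/
theorem exists_addCommGroup {Y : Type u} [UniformSpace Y] [CompactSpace Y] [T2Space Y]
    [AddAction T Y] [AddAction.IsMinimal T Y]
    (hY : Equicontinuous (fun (t : T) (y : Y) => t +ᵥ y)) (y₀ : Y) :
    ∃ _ : AddCommGroup Y, IsTopologicalAddGroup Y ∧ (0 : Y) = y₀ ∧
      ∀ (t : T) (ξ η : Y), t +ᵥ (ξ + η) = (t +ᵥ ξ) + η := by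
  have hU := CompactSpace.uniformEquicontinuous_of_equicontinuous hY
  let o : T → Y := fun t => t +ᵥ y₀
  let _ : UniformSpace T := UniformSpace.comap o inferInstance
  have ho : IsUniformInducing o := ⟨rfl⟩
  have : IsUniformAddGroup T := by
    refine ⟨?_⟩
    rw [ho.uniformContinuous_iff]
    intro W hW
    obtain ⟨W', hW', hWW⟩ := comp_mem_uniformity_sets hW
    have hV := hU W' hW'
    obtain ⟨V, hV, hVs, hVW⟩ := symm_of_uniformity hV
    have hV2 : {p : T × T | (o p.1, o p.2) ∈ V} ∈ uniformity T := ⟨V, hV, fun _ h => h⟩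
    rw [Filter.mem_map, uniformity_prod_eq_prod, Filter.mem_map]
    refine Filter.mem_of_superset (Filter.prod_mem_prod hV2 hV2) ?_
    rintro ⟨⟨a, a'⟩, ⟨b, b'⟩⟩ ⟨h1, h2⟩
    apply hWW
    refine ⟨(a' - b) +ᵥ y₀, ?_, ?_⟩
    · have := hVW h1 (-b)
      simp only [o, ← add_vadd] at this ⊢
      have e1 : a - b = -b + a := by abel
      have e2 : a' - b = -b + a' := by abel
      change ((a - b) +ᵥ y₀, (a' - b) +ᵥ y₀) ∈ W'
      rw [e1, e2]
      exact this
    · have := hVW (hVs.symm _ _ h2) (a' - b - b')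
      simp only [o, ← add_vadd] at this ⊢
      have e1 : a' - b' = a' - b - b' + b := by abel
      have e2 : a' - b = a' - b - b' + b' := by abel
      change ((a' - b) +ᵥ y₀, (a' - b') +ᵥ y₀) ∈ W'
      rw [← e1, ← e2] at this
      exact this
  let pkg : AbstractCompletion T :=
    { space := Y
      coe := o
      uniformStruct := inferInstance
      complete := inferInstance
      separation := inferInstance
      isUniformInducing := ho
      dense := denseRange_vadd T y₀ }
  let e : UniformSpace.Completion T ≃ᵤ Y :=
    (UniformSpace.Completion.cPkg (α := T)).compareEquiv pkg
  have he : ∀ t : T, e (t : UniformSpace.Completion T) = t +ᵥ y₀ := fun t =>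
    (UniformSpace.Completion.cPkg (α := T)).compare_coe pkg t
  let G : AddCommGroup Y := e.symm.toEquiv.addCommGroup
  have hadd : ∀ ξ η : Y, ξ + η = e (e.symm ξ + e.symm η) := fun _ _ => rfl
  have hneg : ∀ ξ : Y, -ξ = e (-e.symm ξ) := fun _ => rfl
  have hG : IsTopologicalAddGroup Y :=
    { continuous_add := by
        simp only [hadd]
        exact e.continuous.comp ((e.symm.continuous.comp continuous_fst).add
          (e.symm.continuous.comp continuous_snd))
      continuous_neg := by
        simp only [hneg]
        exact e.continuous.comp e.symm.continuous.neg }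
  refine ⟨G, hG, ?_, ?_⟩
  · have : (0 : Y) = e ((0 : T) : UniformSpace.Completion T) := rfl
    rw [this, he, zero_vadd]
  · have h0 : ∀ (t : T) (ξ : Y), t +ᵥ ξ = (t +ᵥ y₀) + ξ := by
      intro t ξ
      refine (denseRange_vadd T y₀).induction_on
        (p := fun ξ : Y => t +ᵥ ξ = (t +ᵥ y₀) + ξ) ξ ?_ ?_
      · exact isClosed_eq (hY.continuous t) (continuous_const.add continuous_id)
      · intro s
        show t +ᵥ (s +ᵥ y₀) = (t +ᵥ y₀) + (s +ᵥ y₀)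
        rw [← add_vadd, hadd, ← he, ← he, ← he, e.symm_apply_apply, e.symm_apply_apply,
          UniformSpace.Completion.coe_add]
    intro t ξ η
    rw [h0 t (ξ + η), h0 t ξ, add_assoc]

theorem MaxFactor.exists_group [CompactSpace X] [AddAction.IsMinimal T X] :
    ∃ _ : AddCommGroup (MaxFactor T x₀), IsTopologicalAddGroup (MaxFactor T x₀) ∧
      (0 : MaxFactor T x₀) = MaxFactor.proj T x₀ x₀ ∧
      ∀ (t : T) (ξ η : MaxFactor T x₀), t +ᵥ (ξ + η) = (t +ᵥ ξ) + η :=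
  letI : UniformSpace (MaxFactor T x₀) := uniformSpaceOfCompactR1
  exists_addCommGroup T (MaxFactor.equicontinuous T x₀) (MaxFactor.proj T x₀ x₀)

/-- The group structure of `X_max`: the one (it is unique, by density of orbits) which makes
`X_max` a topological group with neutral element `π x₀` on which `T` acts by translations. -/
noncomputable instance MaxFactor.group [CompactSpace X] [AddAction.IsMinimal T X] :
    AddCommGroup (MaxFactor T x₀) :=
  (MaxFactor.exists_group T x₀).choose

instance MaxFactor.isTopologicalAddGroup [CompactSpace X] [AddAction.IsMinimal T X] :
    IsTopologicalAddGroup (MaxFactor T x₀) :=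
  (MaxFactor.exists_group T x₀).choose_spec.1

theorem MaxFactor.zero_eq [CompactSpace X] [AddAction.IsMinimal T X] :
    (0 : MaxFactor T x₀) = MaxFactor.proj T x₀ x₀ :=
  (MaxFactor.exists_group T x₀).choose_spec.2.1

theorem MaxFactor.vadd_add [CompactSpace X] [AddAction.IsMinimal T X] (t : T)
    (ξ η : MaxFactor T x₀) : t +ᵥ (ξ + η) = (t +ᵥ ξ) + η :=
  (MaxFactor.exists_group T x₀).choose_spec.2.2 t ξ η

end Equicontinuous

section Proximal

/-- Two points are proximal if `inf_t d(t x, t y) = 0`. -/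
def Proximal (T : Type v) {X : Type u} [AddCommGroup T] [MetricSpace X] [AddAction T X]
    (x y : X) : Prop :=
  ⨅ t : T, dist (t +ᵥ x) (t +ᵥ y) = 0

variable (T : Type v) {X : Type u} [AddCommGroup T] [MetricSpace X] [AddAction T X] (x₀ : X)

/-- A point of `X_max` is singular if its fibre contains two (distinct) proximal points. -/
def IsSingular (ξ : MaxFactor T x₀) : Prop :=
  ∃ x y : X, MaxFactor.proj T x₀ x = ξ ∧ MaxFactor.proj T x₀ y = ξ ∧ x ≠ y ∧ Proximal T x y

/-- `L^sing`: the subgroup of `X_max` generated by the differences of singular points. -/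
noncomputable def singSubgroup [CompactSpace X] [AddAction.IsMinimal T X] :
    AddSubgroup (MaxFactor T x₀) :=
  AddSubgroup.closure
    {ζ | ∃ ξ ξ' : MaxFactor T x₀, IsSingular T x₀ ξ ∧ IsSingular T x₀ ξ' ∧ ζ = ξ - ξ'}

end Proximal

section Ellis

variable (T : Type v) (X : Type u) [AddCommGroup T] [TopologicalSpace X] [AddAction T X]

/-- The Ellis semigroup: the closure of the acting homeomorphisms in `X → X`, in the topology of
pointwise convergence; the semigroup operation is composition of maps. -/
def ellis : Set (X → X) := closure (range fun (t : T) (x : X) => t +ᵥ x)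

/-- The kernel of the Ellis semigroup, i.e. its smallest (nonempty) two-sided ideal. -/
def ellisKernel : Set (X → X) :=
  ⋂₀ {I | I ⊆ ellis T X ∧ I.Nonempty ∧ ∀ f ∈ ellis T X, ∀ g ∈ I, f ∘ g ∈ I ∧ g ∘ f ∈ I}

/-- Minimal idempotents: the idempotents of the kernel of the Ellis semigroup. -/
def IsMinimalIdempotent (e : X → X) : Prop := e ∈ ellisKernel T X ∧ e ∘ e = e

variable {X}

/-- The structure group `H_e = e E e`. -/
def structureGroup (e : X → X) : Set (X → X) := {h | ∃ f ∈ ellis T X, h = e ∘ f ∘ e}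

end Ellis

end TopDyn

/-! Part (1) is a dichotomy for analytic subgroups. An open subgroup of a compact group has finite
index. Conversely, proximality is a Gδ relation, so the singular points form an analytic set and
`singSubgroup` is an analytic subgroup. Analytic sets have the Baire property, so by Pettis a
non-open analytic subgroup is meagre, and Mycielski's argument produces continuum many points in
distinct cosets (`AddSubgroup.continuum_le_mk_quotient`).

For part (2), every element of the Ellis semigroup acts on `MaxFactor` as a translation. Idempotents
therefore act there trivially, and they fix every point of `X` over a nonsingular point. If
proximality is not transitive, then `e ∘ p ∘ r ≠ e` for some idempotents `p` and `r` with `r ∘ e =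
r`. This element of the structure group differs from `e` only over singular points, hence only over
one coset of `singSubgroup`. Conjugating by elements of the structure group that induce arbitrary
translations moves its support to any prescribed coset (`exists_mem_structureGroup_supported`).

Elements supported over different cosets do not interfere. Finite products of them are pointwise
limits' approximants for arbitrary products, and the Ellis semigroup is closed, so each set of
cosets yields its own element (`glue_mem_structureGroup`). With at least continuum many cosets this
gives the lower bound; the upper bound is the cardinality of `X → X`. -/

/-! ### Second countability of Hausdorff quotients -/

/-- A Hausdorff continuous image of a second countable compact space is second countable. -/
theorem Continuous.secondCountableTopology_of_surjective {X Y : Type*} [TopologicalSpace X]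
    [TopologicalSpace Y] [CompactSpace X] [SecondCountableTopology X] [T2Space Y] {f : X → Y}
    (hf : Continuous f) (hs : Function.Surjective f) : SecondCountableTopology Y := by
  let B := TopologicalSpace.countableBasis X
  have hB := TopologicalSpace.isBasis_countableBasis X
  have hcl : IsClosedMap f := hf.isClosedMap
  -- The set attached to `F` consists of the points whose whole fibre lies in `⋃₀ F`; it is open
  -- because `f` is a closed map.
  let C : Set (Set Y) := (fun F : Set (Set X) => (f '' (⋃₀ F)ᶜ)ᶜ) '' {F | F.Finite ∧ F ⊆ B}
  have hC : C.Countable :=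
    (countable_ofPred_finite_subset (TopologicalSpace.countable_countableBasis X)).image _
  have hopen : ∀ U ∈ C, IsOpen U := by
    rintro _ ⟨F, ⟨-, hF⟩, rfl⟩
    exact (hcl _ (isOpen_sUnion fun U hU => hB.isOpen (hF hU)).isClosed_compl).isOpen_compl
  refine (TopologicalSpace.isTopologicalBasis_of_isOpen_of_nhds hopen ?_).secondCountableTopology hC
  intro y U hy hU
  have hK : IsCompact (f ⁻¹' {y}) := (isClosed_singleton.preimage hf).isCompact
  have hsub : f ⁻¹' {y} ⊆ f ⁻¹' U := by
    rintro x rfl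
    exact hy
  have hcov : ∀ x ∈ f ⁻¹' {y}, ∃ V ∈ B, x ∈ V ∧ V ⊆ f ⁻¹' U := fun x hx =>
    hB.exists_subset_of_mem_open (hsub hx) (hU.preimage hf)
  let D : Set (Set X) := {V | V ∈ B ∧ V ⊆ f ⁻¹' U}
  obtain ⟨F, hFD, hFfin, hF⟩ := hK.elim_finite_subcover_image (b := D) (c := id)
    (fun V hV => hB.isOpen hV.1) (by
      intro x hx
      obtain ⟨V, hV, hxV, hVU⟩ := hcov x hx
      exact mem_biUnion (show V ∈ D from ⟨hV, hVU⟩) hxV)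
  refine ⟨_, ⟨F, ⟨hFfin, fun V hV => (hFD hV).1⟩, rfl⟩, ?_, ?_⟩
  · rintro ⟨x, hx, hxy⟩
    apply hx
    obtain ⟨V, hV, hxV⟩ := mem_iUnion₂.1 (hF hxy)
    exact ⟨V, hV, hxV⟩
  · intro z hz
    obtain ⟨x, rfl⟩ := hs z
    by_contra hxU
    refine hz ⟨x, ?_, rfl⟩
    rintro ⟨V, hV, hxV⟩
    exact hxU ((hFD hV).2 hxV)

/-! ### The Baire property of analytic sets -/

section BaireProperty

variable {X : Type*} [TopologicalSpace X]

/-- The largest open set in which `A` is locally meagre. -/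
def meagreKernel (A : Set X) : Set X := ⋃₀ {U | IsOpen U ∧ IsMeagre (U ∩ A)}

theorem isOpen_meagreKernel (A : Set X) : IsOpen (meagreKernel A) :=
  isOpen_sUnion fun _ hU => hU.1

theorem isMeagre_meagreKernel_inter [SecondCountableTopology X] (A : Set X) :
    IsMeagre (meagreKernel A ∩ A) := by
  obtain ⟨S, hS, hSc, hSeq⟩ := TopologicalSpace.isOpen_sUnion_countable
    {U | IsOpen U ∧ IsMeagre (U ∩ A)} (fun _ hU => hU.1)
  rw [meagreKernel, ← hSeq, sUnion_eq_biUnion, iUnion₂_inter]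
  exact isMeagre_biUnion hS fun U hU => (hSc hU).2

theorem mem_closure_of_notMem_meagreKernel {A : Set X} {x : X} (hx : x ∉ meagreKernel A) :
    x ∈ closure A := by
  by_contra h
  refine hx ⟨(closure A)ᶜ, ⟨isClosed_closure.isOpen_compl, ?_⟩, h⟩
  have : (closure A)ᶜ ∩ A = ∅ := by
    ext y
    simpa using fun hy hA => hy (subset_closure hA)
  rw [this]
  exact IsMeagre.empty

/-- The intersection of the kernels agrees with an open set `U` up to a meagre set and meets every
`A n` in a meagre set. So `U` meets the union in a meagre set, and `U` lies in the kernel of the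
union by maximality. -/
theorem isMeagre_iInter_meagreKernel_diff [SecondCountableTopology X] {A : ℕ → Set X} :
    IsMeagre ((⋂ n, meagreKernel (A n)) \ meagreKernel (⋃ n, A n)) := by
  set W := ⋂ n, meagreKernel (A n) with hWdef
  have hW : BaireMeasurableSet W :=
    .iInter fun n => (isOpen_meagreKernel _).baireMeasurableSet
  obtain ⟨U, hU, hWU⟩ := hW.residualEq_isOpen
  have h1 : IsMeagre (W ∩ ⋃ n, A n) := by
    rw [inter_iUnion]
    refine isMeagre_iUnion fun n => (isMeagre_meagreKernel_inter (A n)).mono ?_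
    exact inter_subset_inter_left _ (iInter_subset _ n)
  have h2 : IsMeagre (U \ W) := by
    filter_upwards [Filter.eventuallyEq_set.1 hWU] with x hx hxU
    exact hxU.2 (hx.2 hxU.1)
  have h3 : IsMeagre (W \ U) := by
    filter_upwards [Filter.eventuallyEq_set.1 hWU] with x hx hxU
    exact hxU.2 (hx.1 hxU.1)
  have h4 : U ⊆ meagreKernel (⋃ n, A n) := by
    refine subset_sUnion_of_mem ⟨hU, (h1.union h2).mono ?_⟩
    rintro x ⟨hxU, hxA⟩
    by_cases hxW : x ∈ W
    · exact Or.inl ⟨hxW, hxA⟩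
    · exact Or.inr ⟨hxU, hxW⟩
  exact h3.mono (sdiff_subset_sdiff_right h4)

/-- Analytic sets have the Baire property. -/
theorem MeasureTheory.AnalyticSet.baireMeasurableSet [SecondCountableTopology X] [T2Space X]
    {A : Set X} (hA : AnalyticSet A) : BaireMeasurableSet A := by
  rw [AnalyticSet] at hA
  obtain rfl | ⟨f, hf, rfl⟩ := hA
  · exact IsOpen.baireMeasurableSet isOpen_empty
  -- `C s` is the cylinder of sequences that begin with `s`.
  let C : List ℕ → Set (ℕ → ℕ) := fun s => {x | (List.range s.length).map x = s}
  have hC : ∀ s, C s = ⋃ n, C (s ++ [n]) := by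
    intro s
    ext x
    simp only [C, mem_iUnion, mem_ofPred_eq, List.length_append, List.length_singleton,
      List.range_succ, List.map_append, List.map_singleton]
    constructor
    · intro h
      exact ⟨x s.length, by rw [h]⟩
    · rintro ⟨n, h⟩
      exact (List.append_inj' h rfl).1
  let K : List ℕ → Set X := fun s => meagreKernel (f '' C s)
  let M : Set X := ⋃ s, (⋂ n, K (s ++ [n])) \ K s
  have hM : IsMeagre M := by
    refine isMeagre_iUnion fun s => ?_
    have := isMeagre_iInter_meagreKernel_diff (A := fun n => f '' C (s ++ [n]))
    rwa [← image_iUnion, ← hC] at this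
  have hrange : range f = f '' C [] := by
    have : C [] = univ := by simp [C]
    rw [this, image_univ]
  -- Outside `M`, a point that avoids `K s` avoids `K` of some one-step extension of `s`. Starting
  -- from the empty list this gives a branch `α`; the point lies in the closure of the image of
  -- every cylinder around `α`, hence equals `f α` by continuity.
  have hsub : (K [])ᶜ \ M ⊆ range f := by
    rintro x ⟨hx, hxM⟩
    have step : ∀ s, x ∉ K s → ∃ n, x ∉ K (s ++ [n]) := by
      intro s hs
      by_contra! h
      exact hxM (mem_iUnion.2 ⟨s, mem_iInter.2 h, hs⟩)
    have step' : ∀ s, ∃ n, x ∉ K s → x ∉ K (s ++ [n]) := by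
      intro s
      by_cases hs : x ∉ K s
      · obtain ⟨n, hn⟩ := step s hs
        exact ⟨n, fun _ => hn⟩
      · exact ⟨0, fun h => absurd h hs⟩
    choose g hg using step'
    let t : ℕ → List ℕ := fun k => Nat.rec [] (fun _ s => s ++ [g s]) k
    let α : ℕ → ℕ := fun k => g (t k)
    have ht : ∀ k, t k = (List.range k).map α := by
      intro k
      induction k with
      | zero => rfl
      | succ k ih =>
        rw [List.range_succ, List.map_append, ← ih]
        rfl
    have hxt : ∀ k, x ∉ K (t k) := by
      intro k
      induction k with
      | zero => exact hx
      | succ k ih => exact hg _ ih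
    refine ⟨α, ?_⟩
    by_contra hne
    obtain ⟨U, V, hU, hV, hαU, hxV, hd⟩ := t2_separation hne
    have hnhds : f ⁻¹' U ∈ 𝓝 α := (hU.preimage hf).mem_nhds hαU
    rw [(PiNat.isTopologicalBasis_cylinders (fun _ : ℕ => ℕ)).mem_nhds_iff] at hnhds
    obtain ⟨_, ⟨β, k, rfl⟩, hαβ, hsubU⟩ := hnhds
    have hcyl : C (t k) ⊆ PiNat.cylinder β k := by
      intro z hz i hi
      have hz' : (List.range k).map z = (List.range k).map α := by
        have h1 := ht k
        have hlen : (t k).length = k := by simp [h1]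
        have : (List.range (t k).length).map z = t k := hz
        rwa [hlen, h1] at this
      have h2 : z i = α i := List.map_inj_left.1 hz' i (List.mem_range.2 hi)
      rw [h2]
      exact hαβ i hi
    have hcl := mem_closure_of_notMem_meagreKernel (hxt k)
    obtain ⟨y, hyV, z, hz, rfl⟩ := mem_closure_iff.1 hcl V hV hxV
    exact disjoint_left.1 hd (hsubU (hcyl hz)) hyV
  have hclosed : BaireMeasurableSet (K [])ᶜ := (isOpen_meagreKernel _).baireMeasurableSet.compl
  refine hclosed.congr ?_
  have h1 : IsMeagre (K [] ∩ range f) := by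
    rw [hrange]
    exact isMeagre_meagreKernel_inter _
  refine Filter.eventuallyEq_set.2 ?_
  filter_upwards [h1, hM] with x hx hxM
  exact ⟨fun h => hsub ⟨h, hxM⟩, fun h h' => hx ⟨h', h⟩⟩

end BaireProperty

/-! ### Meagre sets and subgroups of topological groups -/

section Groups

variable {G : Type*} [AddCommGroup G] [TopologicalSpace G] [IsTopologicalAddGroup G]

/-- Pettis: a non-meagre subgroup with the Baire property is open. -/
theorem AddSubgroup.isOpen_of_baireMeasurableSet [BaireSpace G] (L : AddSubgroup G)
    (hL : BaireMeasurableSet (L : Set G)) (hm : ¬ IsMeagre (L : Set G)) :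
    IsOpen (L : Set G) := by
  obtain ⟨U, hU, hLU⟩ := hL.residualEq_isOpen
  have hev := Filter.eventuallyEq_set.1 hLU
  have hne : U.Nonempty := by
    rw [nonempty_iff_ne_empty]
    rintro rfl
    apply hm
    filter_upwards [hev] with x hx hxL
    exact hx.1 hxL
  obtain ⟨u, hu⟩ := hne
  refine L.isOpen_of_mem_nhds (g := 0) ?_
  -- For `v` near 0 the open set `U ∩ (U + v)` is nonempty. A generic `x` in it has `x` and `x - v`
  -- both in `L`, so `v ∈ L`.
  have hV : {v : G | v + u ∈ U} ∈ 𝓝 0 :=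
    (hU.preimage (continuous_add_const u)).mem_nhds (by simpa using hu)
  filter_upwards [hV] with v hv
  have h1 : ∀ᶠ x in residual G, (x - v ∈ L ↔ x - v ∈ U) :=
    (tendsto_residual_of_isOpenMap (Homeomorph.subRight v).continuous
      (Homeomorph.subRight v).isOpenMap).eventually hev
  have hdense : Dense {x | (x ∈ L ↔ x ∈ U) ∧ (x - v ∈ L ↔ x - v ∈ U)} :=
    dense_of_mem_residual (hev.and h1)
  obtain ⟨x, ⟨hxU, hxvU⟩, hx1, hx2⟩ := hdense.inter_open_nonempty
    (U ∩ {x | x - v ∈ U}) (hU.inter (hU.preimage (continuous_id.sub continuous_const)))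
    ⟨v + u, hv, by simpa using hu⟩
  have := L.sub_mem (hx1.2 hxU) (hx2.2 hxvU)
  simpa using this

/-- The points are chosen one at a time: each earlier point excludes only a meagre set of choices
for the next one. Both differences must be controlled, as `M` need not be symmetric. -/
theorem IsMeagre.exists_sub_notMem [BaireSpace G] {M : Set G} (hM : IsMeagre M) {ι : Type*}
    [Finite ι] {U : ι → Set G} (hU : ∀ i, IsOpen (U i)) (hne : ∀ i, (U i).Nonempty) :
    ∃ z : ι → G, (∀ i, z i ∈ U i) ∧ ∀ i j, i ≠ j → z i - z j ∉ M := by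
  classical
  have := Fintype.ofFinite ι
  suffices H : ∀ s : Finset ι, ∃ z : ι → G, (∀ i ∈ s, z i ∈ U i) ∧
      ∀ i ∈ s, ∀ j ∈ s, i ≠ j → z i - z j ∉ M by
    obtain ⟨z, h1, h2⟩ := H Finset.univ
    exact ⟨z, fun i => h1 i (Finset.mem_univ i), fun i j =>
      h2 i (Finset.mem_univ i) j (Finset.mem_univ j)⟩
  intro s
  induction s using Finset.induction_on with
  | empty => exact ⟨0, by simp, by simp⟩
  | insert a s ha ih =>
    obtain ⟨z, h1, h2⟩ := ih
    have hres : ∀ᶠ w in residual G, ∀ j ∈ s, w - z j ∉ M ∧ z j - w ∉ M := by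
      rw [Filter.eventually_all_finset]
      intro j _
      exact ((tendsto_residual_of_isOpenMap (Homeomorph.subRight (z j)).continuous
          (Homeomorph.subRight (z j)).isOpenMap).eventually hM).and
        ((tendsto_residual_of_isOpenMap (Homeomorph.subLeft (z j)).continuous
          (Homeomorph.subLeft (z j)).isOpenMap).eventually hM)
    obtain ⟨w, hwU, hw⟩ := (dense_of_mem_residual hres).inter_open_nonempty (U a) (hU a) (hne a)
    have hz : ∀ i ∈ s, Function.update z a w i = z i := fun i hi =>
      Function.update_of_ne (by rintro rfl; exact ha hi) _ _
    refine ⟨Function.update z a w, ?_, ?_⟩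
    · intro i hi
      obtain rfl | hi := Finset.mem_insert.1 hi
      · simpa using hwU
      · rw [hz i hi]
        exact h1 i hi
    · intro i hi j hj hij
      obtain rfl | his := Finset.mem_insert.1 hi
      · obtain rfl | hjs := Finset.mem_insert.1 hj
        · exact absurd rfl hij
        · rw [hz j hjs, Function.update_self]
          exact (hw j hjs).1
      · obtain rfl | hjs := Finset.mem_insert.1 hj
        · rw [hz i his, Function.update_self]
          exact (hw i his).2
        · rw [hz i his, hz j hjs]
          exact h2 i his j hjs hij

end Groups

/-- Mycielski: a meagre subset of a compact metrisable group misses all differences of distinct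
points of some Cantor-indexed family. -/
theorem IsMeagre.exists_cantor_sub_notMem {G : Type*} [AddCommGroup G] [TopologicalSpace G]
    [IsTopologicalAddGroup G] [CompactSpace G] [TopologicalSpace.MetrizableSpace G]
    {M : Set G} (hM : IsMeagre M) :
    ∃ φ : (ℕ → Bool) → G, ∀ x y, x ≠ y → φ x - φ y ∉ M := by
  let _ := TopologicalSpace.metrizableSpaceMetric G
  obtain ⟨S, hSo, hSd, hSc, hSM⟩ := mem_residual_iff.1 hM
  -- Baire category is applied in the space of continuous maps from the Cantor set. Distinct
  -- sequences differ at some coordinate `n`, so a map in all the sets `W n O` has the required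
  -- property.
  let W : ℕ → Set G → Set C(ℕ → Bool, G) := fun n O =>
    {φ | ∀ x y : ℕ → Bool, x n ≠ y n → φ x - φ y ∈ O}
  have hWo : ∀ n, ∀ O ∈ S, IsOpen (W n O) := by
    intro n O hO
    let K : Set ((ℕ → Bool) × (ℕ → Bool)) := {p | p.1 n ≠ p.2 n}
    have hK : IsCompact K := by
      refine IsClosed.isCompact ?_
      have : Continuous fun p : (ℕ → Bool) × (ℕ → Bool) => (p.1 n, p.2 n) := by fun_prop
      exact (isClosed_discrete {b : Bool × Bool | b.1 ≠ b.2}).preimage this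
    let Φ : C(ℕ → Bool, G) → C((ℕ → Bool) × (ℕ → Bool), G) := fun φ =>
      φ.comp ContinuousMap.fst - φ.comp ContinuousMap.snd
    have hΦ : Continuous Φ :=
      (ContinuousMap.continuous_precomp _).sub (ContinuousMap.continuous_precomp _)
    have := (ContinuousMap.isOpen_setOfPred_mapsTo hK (hSo O hO)).preimage hΦ
    convert! this using 1
    ext φ
    exact ⟨fun h p hp => h p.1 p.2 hp, fun h x y hxy => h (x := (x, y)) hxy⟩
  have hWd : ∀ n, ∀ O ∈ S, Dense (W n O) := by
    intro n O hO φ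
    rw [Metric.mem_closure_iff]
    intro ε hε
    have hOm : IsMeagre Oᶜ := by
      rw [IsMeagre, compl_compl]
      exact residual_of_dense_open (hSo O hO) (hSd O hO)
    have hev : ∀ x : ℕ → Bool, ∃ m, ∀ y ∈ PiNat.cylinder x m, dist (φ y) (φ x) < ε / 4 := by
      intro x
      have : φ ⁻¹' Metric.ball (φ x) (ε / 4) ∈ 𝓝 x :=
        φ.continuous.continuousAt (Metric.ball_mem_nhds _ (by positivity))
      rw [(PiNat.isTopologicalBasis_cylinders (fun _ : ℕ => Bool)).mem_nhds_iff] at this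
      obtain ⟨_, ⟨β, k, rfl⟩, hβ, hsub⟩ := this
      refine ⟨k, fun y hy => hsub ?_⟩
      rwa [PiNat.mem_cylinder_iff_eq.1 hβ] at hy
    choose m hm using hev
    obtain ⟨F, -, hF⟩ := isCompact_univ.elim_nhds_subcover (fun x => PiNat.cylinder x (m x))
      (fun x _ => (PiNat.isOpen_cylinder _ x (m x)).mem_nhds (PiNat.self_mem_cylinder x _))
    -- The bound `n + 1` makes coordinate `n` one of the first `N`; the other bound makes `φ` nearly
    -- constant on cylinders of length `N`. The approximating map will depend on the first `N`
    -- coordinates only.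
    let N := max (n + 1) (F.sup m)
    have hN : ∀ x y : ℕ → Bool, y ∈ PiNat.cylinder x N → dist (φ y) (φ x) < ε / 2 := by
      intro x y hy
      obtain ⟨a, haF, hxa⟩ := mem_iUnion₂.1 (hF (mem_univ x))
      have hma : m a ≤ N := (Finset.le_sup haF).trans (le_max_right _ _)
      have hya : y ∈ PiNat.cylinder a (m a) := by
        intro i hi
        rw [hy i (hi.trans_le hma), hxa i hi]
      calc dist (φ y) (φ x) ≤ dist (φ y) (φ a) + dist (φ x) (φ a) := dist_triangle_right _ _ _
        _ < ε / 4 + ε / 4 := add_lt_add (hm a y hya) (hm a x hxa)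
        _ = ε / 2 := by ring
    let ext : (Fin N → Bool) → ℕ → Bool := fun s i => if h : i < N then s ⟨i, h⟩ else false
    let res : (ℕ → Bool) → Fin N → Bool := fun x i => x i
    have hres : Continuous res := continuous_pi fun i => continuous_apply _
    have hcyl : ∀ x, x ∈ PiNat.cylinder (ext (res x)) N := by
      intro x i hi
      simp [ext, res, hi]
    obtain ⟨z, hz1, hz2⟩ := hOm.exists_sub_notMem (ι := Fin N → Bool)
      (U := fun s => Metric.ball (φ (ext s)) (ε / 2)) (fun s => Metric.isOpen_ball)
      (fun s => ⟨_, Metric.mem_ball_self (by positivity)⟩)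
    refine ⟨⟨fun x => z (res x), (continuous_of_discreteTopology (f := z)).comp hres⟩, ?_, ?_⟩
    · intro x y hxy
      have := hz2 (res x) (res y) fun h =>
        hxy (congrFun h ⟨n, (Nat.lt_succ_self n).trans_le (le_max_left _ _)⟩)
      simpa using this
    · rw [ContinuousMap.dist_lt_iff hε]
      intro x
      calc dist (φ x) (z (res x))
          ≤ dist (φ x) (φ (ext (res x))) + dist (z (res x)) (φ (ext (res x))) :=
            dist_triangle_right _ _ _
        _ < ε / 2 + ε / 2 := add_lt_add (hN _ _ (hcyl x)) (hz1 _)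
        _ = ε := add_halves ε
  have : Countable S := hSc.to_subtype
  have hdense : Dense (⋂ p : ℕ × S, W p.1 p.2) :=
    dense_iInter_of_isOpen (fun p => hWo p.1 p.2 p.2.2) fun p => hWd p.1 p.2 p.2.2
  obtain ⟨φ, hφ⟩ := hdense.nonempty
  refine ⟨φ, fun x y hxy => ?_⟩
  obtain ⟨n, hn⟩ := Function.ne_iff.1 hxy
  exact hSM fun O hO => mem_iInter.1 hφ (n, ⟨O, hO⟩) x y hn

/-- An analytic subgroup of a compact metrisable group which is not open has index at least
the continuum. -/
theorem AddSubgroup.continuum_le_mk_quotient {G : Type u} [AddCommGroup G] [TopologicalSpace G]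
    [IsTopologicalAddGroup G] [CompactSpace G] [T2Space G] [SecondCountableTopology G]
    (L : AddSubgroup G) (hL : MeasureTheory.AnalyticSet (L : Set G))
    (ho : ¬ IsOpen (L : Set G)) : Cardinal.continuum.{u} ≤ Cardinal.mk (G ⧸ L) := by
  have hm : IsMeagre (L : Set G) := by
    by_contra h
    exact ho (L.isOpen_of_baireMeasurableSet hL.baireMeasurableSet h)
  obtain ⟨φ, hφ⟩ := hm.exists_cantor_sub_notMem
  have hinj : Function.Injective fun x => (φ x : G ⧸ L) := by
    intro x y hxy
    by_contra hne
    exact hφ y x (Ne.symm hne) (by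
      have := QuotientAddGroup.eq.1 hxy
      rwa [neg_add_eq_sub] at this)
  have := Cardinal.mk_le_of_injective
    ((hinj.comp ULift.down_injective : Function.Injective
      fun x : ULift.{u} (ℕ → Bool) => (φ x.down : G ⧸ L)))
  simpa using this

/-! ### The Ellis semigroup and its structure groups -/

namespace TopDyn

section EllisSemigroup

variable {T : Type v} {X : Type u} [AddCommGroup T] [TopologicalSpace X] [AddAction T X]

theorem vadd_mem_ellis (t : T) : (fun x : X => t +ᵥ x) ∈ ellis T X := subset_closure ⟨t, rfl⟩

theorem isClosed_ellis : IsClosed (ellis T X) := isClosed_closure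

theorem isCompact_ellis [CompactSpace X] : IsCompact (ellis T X) := isClosed_ellis.isCompact

theorem continuous_comp_right (g : X → X) : Continuous fun f : X → X => f ∘ g :=
  continuous_pi fun x => continuous_apply (g x)

theorem comp_mem_ellis [ContinuousConstVAdd T X] {f g : X → X} (hf : f ∈ ellis T X)
    (hg : g ∈ ellis T X) : f ∘ g ∈ ellis T X := by
  have h1 : ∀ t : T, (fun x => t +ᵥ x) ∘ g ∈ ellis T X := by
    intro t
    have hc : Continuous fun g : X → X => (fun x => t +ᵥ x) ∘ g :=
      continuous_pi fun x => (continuous_const_vadd t).comp (continuous_apply x)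
    refine map_mem_closure hc hg ?_
    rintro _ ⟨s, rfl⟩
    exact ⟨t + s, funext fun x => add_vadd t s x⟩
  have h2 : f ∘ g ∈ closure (ellis T X) := by
    refine map_mem_closure (f := fun f : X → X => f ∘ g) (continuous_comp_right g) hf ?_
    rintro _ ⟨t, rfl⟩
    exact h1 t
  rwa [isClosed_ellis.closure_eq] at h2

/-- The Ellis idempotent lemma for compact semigroups of self-maps. -/
theorem exists_idempotent_of_isCompact [T2Space X] {s : Set (X → X)} (hne : s.Nonempty)
    (hs : IsCompact s) (hcomp : ∀ f ∈ s, ∀ g ∈ s, f ∘ g ∈ s) : ∃ p ∈ s, p ∘ p = p := by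
  let _ : Semigroup (X → X) :=
    { mul := fun f g => f ∘ g
      mul_assoc := fun _ _ _ => rfl }
  exact exists_idempotent_in_compact_subsemigroup (M := X → X) continuous_comp_right s hne hs
    hcomp

/-- Evaluating a closed left ideal at `x` gives a nonempty closed invariant set, which is all of `X`
by minimality. -/
theorem exists_apply_eq_of_left_invariant [CompactSpace X] [T2Space X] [AddAction.IsMinimal T X]
    {I : Set (X → X)} (hI : IsClosed I) (hne : I.Nonempty)
    (hinv : ∀ f ∈ ellis T X, ∀ g ∈ I, f ∘ g ∈ I) (x y : X) : ∃ f ∈ I, f x = y := by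
  have hcl : IsClosed ((fun f : X → X => f x) '' I) :=
    (hI.isCompact.image (continuous_apply x)).isClosed
  have huniv := (eq_empty_or_univ_of_vadd_invariant_closed T hcl (by
    rintro t _ ⟨_, ⟨f, hf, rfl⟩, rfl⟩
    exact ⟨_, hinv _ (vadd_mem_ellis t) f hf, rfl⟩)).resolve_left
      (hne.image _).ne_empty
  have : y ∈ (fun f : X → X => f x) '' I := huniv ▸ mem_univ y
  exact this

theorem exists_mem_ellis_apply_eq [CompactSpace X] [T2Space X] [ContinuousConstVAdd T X]
    [AddAction.IsMinimal T X] (x y : X) : ∃ f ∈ ellis T X, f x = y :=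
  exists_apply_eq_of_left_invariant (T := T) isClosed_ellis ⟨_, vadd_mem_ellis 0⟩
    (fun _ hf _ hg => comp_mem_ellis hf hg) x y

/-- The elements of the left ideal `Ee` that fix `x` form a nonempty compact semigroup, which
contains an idempotent. -/
theorem exists_idempotent_apply_eq_self [CompactSpace X] [T2Space X] [ContinuousConstVAdd T X]
    [AddAction.IsMinimal T X] {e : X → X} (he : e ∈ ellis T X) (hee : e ∘ e = e) (x : X) :
    ∃ r ∈ ellis T X, r ∘ r = r ∧ r ∘ e = r ∧ r x = x := by
  let I : Set (X → X) := (fun f => f ∘ e) '' ellis T X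
  have hI : IsClosed I := (isCompact_ellis.image (continuous_comp_right e)).isClosed
  have hinv : ∀ f ∈ ellis T X, ∀ g ∈ I, f ∘ g ∈ I := by
    rintro f hf _ ⟨g, hg, rfl⟩
    exact ⟨f ∘ g, comp_mem_ellis hf hg, rfl⟩
  have hIE : I ⊆ ellis T X := by
    rintro _ ⟨g, hg, rfl⟩
    exact comp_mem_ellis hg he
  obtain ⟨f, hf, hfx⟩ := exists_apply_eq_of_left_invariant hI
    (⟨_, e, he, rfl⟩ : I.Nonempty) hinv x x
  have hJ : IsClosed (I ∩ {f | f x = x}) :=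
    hI.inter (isClosed_eq (continuous_apply x) continuous_const)
  obtain ⟨r, ⟨hrI, hrx⟩, hr⟩ := exists_idempotent_of_isCompact (⟨f, hf, hfx⟩ : (I ∩ {f | f x = x}).Nonempty) hJ.isCompact (by
    rintro f ⟨hf, hfx : f x = x⟩ g ⟨hg, hgx : g x = x⟩
    refine ⟨hinv f (hIE hf) g hg, ?_⟩
    change f (g x) = x
    rw [hgx, hfx])
  refine ⟨r, hIE hrI, hr, ?_, hrx⟩
  obtain ⟨g, -, rfl⟩ := hrI
  change g ∘ (e ∘ e) = g ∘ e
  rw [hee]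

/-- Zorn's lemma is applied to closed left ideals only. This suffices because every principal left
ideal is closed, being the image of a compact set under right composition. -/
theorem exists_minimal_left_ideal [CompactSpace X] [T2Space X] [ContinuousConstVAdd T X] :
    ∃ N ⊆ ellis T X, N.Nonempty ∧ (∀ f ∈ ellis T X, ∀ g ∈ N, f ∘ g ∈ N) ∧
      ∀ g ∈ N, ∀ n ∈ N, ∃ f ∈ ellis T X, f ∘ g = n := by
  let S : Set (Set (X → X)) :=
    {N | IsClosed N ∧ N ⊆ ellis T X ∧ N.Nonempty ∧ ∀ f ∈ ellis T X, ∀ g ∈ N, f ∘ g ∈ N}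
  have hES : ellis T X ∈ S :=
    ⟨isClosed_ellis, subset_rfl, ⟨_, vadd_mem_ellis 0⟩, fun _ hf _ hg => comp_mem_ellis hf hg⟩
  obtain ⟨N, -, hN⟩ := zorn_superset_nonempty S (by
    intro c hcS hc hcne
    refine ⟨⋂₀ c, ⟨isClosed_sInter fun t ht => (hcS ht).1, ?_, ?_, ?_⟩,
      fun s hs => sInter_subset_of_mem hs⟩
    · obtain ⟨t, ht⟩ := hcne
      exact (sInter_subset_of_mem ht).trans (hcS ht).2.1
    · exact IsCompact.nonempty_sInter_of_directed_nonempty_isCompact_isClosed (hS := hcne.to_subtype)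
        (IsChain.directedOn hc.symm) (fun t ht => (hcS ht).2.2.1) (fun t ht => (hcS ht).1.isCompact)
        (fun t ht => (hcS ht).1)
    · intro f hf g hg t ht
      exact (hcS ht).2.2.2 f hf g (hg t ht)) _ hES
  obtain ⟨-, hNE, hNne, hNinv⟩ := hN.prop
  refine ⟨N, hNE, hNne, hNinv, ?_⟩
  intro g hg n hn
  let I : Set (X → X) := (fun f => f ∘ g) '' ellis T X
  have hIS : I ∈ S := by
    refine ⟨(isCompact_ellis.image (continuous_comp_right g)).isClosed, ?_,
      ⟨_, _, vadd_mem_ellis 0, rfl⟩, ?_⟩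
    · rintro _ ⟨f, hf, rfl⟩
      exact comp_mem_ellis hf (hNE hg)
    · rintro f hf _ ⟨h, hh, rfl⟩
      exact ⟨f ∘ h, comp_mem_ellis hf hh, rfl⟩
  have hIN : I ⊆ N := by
    rintro _ ⟨f, hf, rfl⟩
    exact hNinv f hf g hg
  have : n ∈ I := hN.le_of_le hIS hIN hn
  exact this

theorem ellisKernel_subset [ContinuousConstVAdd T X] : ellisKernel T X ⊆ ellis T X :=
  sInter_subset_of_mem ⟨subset_rfl, ⟨_, vadd_mem_ellis 0⟩, fun _ hf _ hg =>
    ⟨comp_mem_ellis hf hg, comp_mem_ellis hg hf⟩⟩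

/-- For a minimal left ideal `N`, the products of `N` with the Ellis semigroup on the right form a
two-sided ideal, so `e = n ∘ b` with `n ∈ N`. Minimality of `N` allows `g` to be undone on `n`,
hence on `e`. -/
theorem IsMinimalIdempotent.exists_comp_eq [CompactSpace X] [T2Space X] [ContinuousConstVAdd T X]
    {e g : X → X} (he : IsMinimalIdempotent T X e) (hg : g ∈ ellis T X) (hge : g ∘ e = g) :
    ∃ h ∈ ellis T X, h ∘ g = e := by
  obtain ⟨N, hNE, ⟨n₀, hn₀⟩, hNinv, hNmin⟩ := exists_minimal_left_ideal (T := T) (X := X)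
  let J : Set (X → X) := {k | ∃ n ∈ N, ∃ b ∈ ellis T X, k = n ∘ b}
  have heJ : e ∈ J := by
    refine he.1 J ⟨?_, ?_, ?_⟩
    · rintro _ ⟨n, hn, b, hb, rfl⟩
      exact comp_mem_ellis (hNE hn) hb
    · exact ⟨_, n₀, hn₀, _, vadd_mem_ellis 0, rfl⟩
    · rintro f hf _ ⟨n, hn, b, hb, rfl⟩
      exact ⟨⟨f ∘ n, hNinv f hf n hn, b, hb, rfl⟩, ⟨n, hn, b ∘ f, comp_mem_ellis hb hf, rfl⟩⟩
  obtain ⟨n, hn, b, -, heq⟩ := heJ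
  obtain ⟨h, hh, hhn⟩ := hNmin (g ∘ n) (hNinv g hg n hn) n hn
  refine ⟨h, hh, ?_⟩
  calc h ∘ g = h ∘ (g ∘ e) := by rw [hge]
    _ = (h ∘ (g ∘ n)) ∘ b := by rw [heq]; rfl
    _ = e := by rw [hhn, ← heq]

section StructureGroup

variable {e : X → X}

theorem mem_structureGroup_iff [ContinuousConstVAdd T X] (he : e ∈ ellis T X) (hee : e ∘ e = e)
    {f : X → X} :
    f ∈ structureGroup T e ↔ f ∈ ellis T X ∧ (∀ x, e (f x) = f x) ∧ ∀ x, f (e x) = f x := by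
  have hee' : ∀ x, e (e x) = e x := congrFun hee
  constructor
  · rintro ⟨g, hg, rfl⟩
    exact ⟨comp_mem_ellis he (comp_mem_ellis hg he), by simp [hee'], by simp [hee']⟩
  · rintro ⟨hf, h1, h2⟩
    exact ⟨f, hf, funext fun x => by simp [h1, h2]⟩

theorem IsMinimalIdempotent.mem_ellis [ContinuousConstVAdd T X] (he : IsMinimalIdempotent T X e) :
    e ∈ ellis T X := ellisKernel_subset he.1

theorem IsMinimalIdempotent.exists_inverse [CompactSpace X] [T2Space X] [ContinuousConstVAdd T X]
    (he : IsMinimalIdempotent T X e) {g : X → X} (hg : g ∈ structureGroup T e) :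
    ∃ g' ∈ structureGroup T e, g' ∘ g = e ∧ g ∘ g' = e := by
  have hmem := fun f : X → X => mem_structureGroup_iff he.mem_ellis he.2 (f := f)
  have left : ∀ g ∈ structureGroup T e, ∃ g' ∈ structureGroup T e, ∀ x, g' (g x) = e x := by
    intro g hg
    obtain ⟨hgE, hg1, hg2⟩ := (hmem g).1 hg
    obtain ⟨h, hh, hhg⟩ := he.exists_comp_eq hgE (funext hg2)
    refine ⟨_, ⟨h, hh, rfl⟩, fun x => ?_⟩
    have h1 : h (g x) = e x := congrFun hhg x
    have h2 : e (e x) = e x := congrFun he.2 x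
    simp [hg1, h1, h2]
  -- In a monoid where every element has a left inverse, left inverses are two-sided.
  obtain ⟨g', hg', h1⟩ := left g hg
  obtain ⟨g'', hg'', h2⟩ := left g' hg'
  refine ⟨g', hg', funext h1, funext fun x => ?_⟩
  have h3 := ((hmem g).1 hg).2.1
  have h4 := ((hmem g').1 hg').2.1
  calc g (g' x) = e (g (g' x)) := (h3 _).symm
    _ = g'' (g' (g (g' x))) := (h2 _).symm
    _ = g'' (e (g' x)) := by rw [h1]
    _ = e x := by rw [h4, h2]

theorem comp_mem_structureGroup [ContinuousConstVAdd T X] (he : e ∈ ellis T X) (hee : e ∘ e = e)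
    {f g : X → X} (hf : f ∈ structureGroup T e) (hg : g ∈ structureGroup T e) :
    f ∘ g ∈ structureGroup T e := by
  rw [mem_structureGroup_iff he hee] at hf hg ⊢
  refine ⟨comp_mem_ellis hf.1 hg.1, fun x => ?_, fun x => ?_⟩
  · simp [hf.2.1]
  · simp [hg.2.2]

/-- A basic neighbourhood for pointwise convergence constrains finitely many values. This is what
turns finite products into infinite gluings. -/
theorem mem_ellis_of_forall_finset {f : X → X}
    (h : ∀ s : Finset X, ∃ g ∈ ellis T X, ∀ x ∈ s, g x = f x) : f ∈ ellis T X := by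
  rw [← isClosed_ellis.closure_eq, mem_closure_iff_nhds]
  intro U hU
  rw [nhds_pi, Filter.mem_pi] at hU
  obtain ⟨I, hI, t, ht, hsub⟩ := hU
  obtain ⟨g, hg, hgf⟩ := h hI.toFinset
  refine ⟨g, hsub fun x hx => ?_, hg⟩
  rw [hgf x (hI.mem_toFinset.2 hx)]
  exact mem_of_mem_nhds (ht x)

end StructureGroup

end EllisSemigroup

/-! ### Proximality and idempotents -/

section ProximalRelation

variable {T : Type v} {X : Type u} [AddCommGroup T] [MetricSpace X] [CompactSpace X]
  [AddAction T X]

/-- The infimum over `T` becomes a minimum over the compact Ellis semigroup. -/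
theorem proximal_iff_exists_mem_ellis {x y : X} :
    Proximal T x y ↔ ∃ f ∈ ellis T X, f x = f y := by
  have hc : Continuous fun f : X → X => dist (f x) (f y) :=
    (continuous_apply x).dist (continuous_apply y)
  have hb : BddBelow (range fun t : T => dist (t +ᵥ x) (t +ᵥ y)) :=
    ⟨0, by rintro _ ⟨t, rfl⟩; exact dist_nonneg⟩
  constructor
  · intro h
    obtain ⟨f, hf, hmin⟩ := isCompact_ellis.exists_isMinOn ⟨_, vadd_mem_ellis (0 : T)⟩
      hc.continuousOn
    refine ⟨f, hf, dist_le_zero.1 ?_⟩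
    rw [← h]
    exact le_ciInf fun t => hmin (vadd_mem_ellis t)
  · rintro ⟨f, hf, hfxy⟩
    have hsub : ellis T X ⊆ {f | ⨅ t : T, dist (t +ᵥ x) (t +ᵥ y) ≤ dist (f x) (f y)} := by
      refine closure_minimal ?_ (isClosed_le continuous_const hc)
      rintro _ ⟨t, rfl⟩
      exact ciInf_le hb t
    have := hsub hf
    refine le_antisymm ?_ (le_ciInf fun t => dist_nonneg)
    simpa [hfxy] using this

theorem Proximal.exists_idempotent [ContinuousConstVAdd T X] {x y : X} (h : Proximal T x y) :
    ∃ p ∈ ellis T X, p ∘ p = p ∧ p x = p y := by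
  obtain ⟨f, hf, hfxy⟩ := proximal_iff_exists_mem_ellis.1 h
  have hcl : IsClosed (ellis T X ∩ {f | f x = f y}) :=
    isClosed_ellis.inter (isClosed_eq (continuous_apply x) (continuous_apply y))
  obtain ⟨p, ⟨hp, hpxy⟩, hpp⟩ := exists_idempotent_of_isCompact (⟨f, hf, hfxy⟩ : (ellis T X ∩ {f | f x = f y}).Nonempty) hcl.isCompact (by
    rintro f ⟨hf, -⟩ g ⟨hg, hgxy : g x = g y⟩
    exact ⟨comp_mem_ellis hf hg, congrArg f hgxy⟩)
  exact ⟨p, hp, hpp, hpxy⟩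

/-- If an idempotent `e` absorbs all products `p r` of idempotents with `r ∈ Ee`, then `e`
identifies proximal points, so proximality is transitive. -/
theorem proximal_trans_of_forall_idempotent [ContinuousConstVAdd T X] [AddAction.IsMinimal T X]
    {e : X → X} (he : e ∈ ellis T X) (hee : e ∘ e = e)
    (H : ∀ p ∈ ellis T X, p ∘ p = p → ∀ r ∈ ellis T X, r ∘ r = r → r ∘ e = r → e ∘ p ∘ r = e)
    {x y z : X} (hxy : Proximal T x y) (hyz : Proximal T y z) : Proximal T x z := by
  have key : ∀ {x y : X}, Proximal T x y → e x = e y := by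
    intro x y hxy
    obtain ⟨p, hp, hpp, hpxy⟩ := hxy.exists_idempotent
    -- Choosing `r` to fix `w` makes `e ∘ p ∘ r = e`, evaluated at `w`, the desired equality.
    have h1 : ∀ w, e (p w) = e w := by
      intro w
      obtain ⟨r, hr, hrr, hre, hrw⟩ := exists_idempotent_apply_eq_self he hee w
      have := congrFun (H p hp hpp r hr hrr hre) w
      simpa [hrw] using this
    rw [← h1 x, ← h1 y, hpxy]
  exact proximal_iff_exists_mem_ellis.2 ⟨e, he, (key hxy).trans (key hyz)⟩

end ProximalRelation

/-! ### Translations induced on the maximal equicontinuous factor -/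

section MaxFactorTranslation

variable {T : Type v} {X : Type u} [AddCommGroup T] [MetricSpace X] [CompactSpace X]
  [AddAction T X] [AddAction.IsMinimal T X] (x₀ : X)

/-- Elements of the Ellis semigroup act on the maximal equicontinuous factor by translations. -/
theorem exists_proj_apply_eq_add {f : X → X} (hf : f ∈ ellis T X) :
    ∃ c : MaxFactor T x₀, ∀ x, MaxFactor.proj T x₀ (f x) = MaxFactor.proj T x₀ x + c := by
  let π := MaxFactor.proj T x₀
  have hπ : Continuous π := MaxFactor.continuous_proj T x₀
  -- Since `π x₀ = 0`, the translation can be read off at `x₀`, and the condition is closed in `f`.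
  have hsub : ellis T X ⊆ {f | ∀ x, π (f x) = π x + π (f x₀)} := by
    refine closure_minimal ?_ ?_
    · rintro _ ⟨t, rfl⟩ x
      have h := MaxFactor.vadd_add T x₀ t 0 (π x)
      change t +ᵥ π x = π x + (t +ᵥ π x₀)
      rwa [zero_add, add_comm, MaxFactor.zero_eq] at h
    · simp only [ofPred_forall]
      exact isClosed_iInter fun x => isClosed_eq (hπ.comp (continuous_apply x))
        (continuous_const.add (hπ.comp (continuous_apply x₀)))
  exact ⟨_, hsub hf⟩

/-- An idempotent translation of a group is the identity. -/
theorem proj_apply_of_idempotent {p : X → X} (hp : p ∈ ellis T X) (hpp : p ∘ p = p) (x : X) :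
    MaxFactor.proj T x₀ (p x) = MaxFactor.proj T x₀ x := by
  obtain ⟨c, hc⟩ := exists_proj_apply_eq_add x₀ hp
  have h := hc (p x)
  rw [show p (p x) = p x from congrFun hpp x, left_eq_add] at h
  rw [hc, h, add_zero]

/-- The points `p x` and `x` lie in one fibre and are proximal, because `p` identifies them. -/
theorem apply_eq_self_of_not_isSingular {p : X → X} (hp : p ∈ ellis T X) (hpp : p ∘ p = p) {x : X}
    (hx : ¬ IsSingular T x₀ (MaxFactor.proj T x₀ x)) : p x = x := by
  by_contra hne
  exact hx ⟨p x, x, proj_apply_of_idempotent x₀ hp hpp x, rfl, hne,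
    proximal_iff_exists_mem_ellis.2 ⟨p, hp, congrFun hpp x⟩⟩

/-- Minimality provides an element of the Ellis semigroup inducing the translation; composing with
`e` on both sides does not change what it induces. -/
theorem exists_mem_structureGroup_proj_eq [ContinuousConstVAdd T X] {e : X → X} (he : e ∈ ellis T X) (hee : e ∘ e = e)
    (c : MaxFactor T x₀) : ∃ g ∈ structureGroup T e, ∀ x,
      MaxFactor.proj T x₀ (g x) = MaxFactor.proj T x₀ x + c := by
  obtain ⟨y, hy⟩ := MaxFactor.surjective_proj T x₀ (MaxFactor.proj T x₀ x₀ + c)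
  obtain ⟨f, hf, hfy⟩ := exists_mem_ellis_apply_eq (T := T) x₀ y
  obtain ⟨d, hd⟩ := exists_proj_apply_eq_add x₀ hf
  have hdc : d = c := by
    have := hd x₀
    rw [hfy, hy] at this
    exact (add_left_cancel this).symm
  refine ⟨_, ⟨f, hf, rfl⟩, fun x => ?_⟩
  simp only [Function.comp_apply]
  rw [proj_apply_of_idempotent x₀ he hee, hd, proj_apply_of_idempotent x₀ he hee, hdc]

end MaxFactorTranslation

end TopDyn

/-! ### Analytic sets in groups, and a cardinality bound -/

namespace MeasureTheory

theorem AnalyticSet.union {α : Type*} [TopologicalSpace α] {s t : Set α} (hs : AnalyticSet s)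
    (ht : AnalyticSet t) : AnalyticSet (s ∪ t) := by
  rw [union_eq_iUnion]
  exact .iUnion fun b => by cases b <;> assumption

theorem AnalyticSet.image_prod {α β γ : Type*} [TopologicalSpace α] [TopologicalSpace β]
    [TopologicalSpace γ] [PolishSpace α] [PolishSpace β] {s : Set α} {t : Set β}
    (hs : AnalyticSet s) (ht : AnalyticSet t) {f : α × β → γ} (hf : Continuous f) :
    AnalyticSet (f '' s ×ˢ t) := by
  refine AnalyticSet.image_of_continuous ?_ hf
  have : s ×ˢ t = ⋂ b : Bool, cond b (Prod.fst ⁻¹' s) (Prod.snd ⁻¹' t) := by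
    ext p
    simp [and_comm]
  rw [this]
  refine .iInter fun b => ?_
  cases b
  · exact ht.preimage continuous_snd
  · exact hs.preimage continuous_fst

theorem AnalyticSet.addSubgroup_closure {G : Type*} [AddCommGroup G] [TopologicalSpace G]
    [IsTopologicalAddGroup G] [PolishSpace G] {D : Set G} (hD : AnalyticSet D) :
    AnalyticSet (AddSubgroup.closure D : Set G) := by
  have hB : AnalyticSet (D ∪ -D) := hD.union (by
    rw [← Set.image_neg_eq_neg]
    exact hD.image_of_continuous continuous_neg)
  -- `W n` is the set of sums of `n` elements of `D ∪ -D`.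
  let W : ℕ → Set G := fun n =>
    Nat.rec {0} (fun _ S => (fun p : G × G => p.1 + p.2) '' S ×ˢ (D ∪ -D)) n
  have hW : ∀ n, AnalyticSet (W n) := by
    intro n
    induction n with
    | zero => exact isClosed_singleton.analyticSet
    | succ n ih => exact ih.image_prod hB continuous_add
  have hEq : (AddSubgroup.closure D : Set G) = ⋃ n, W n := by
    have hcl : (AddSubgroup.closure D : Set G) = (AddSubmonoid.closure (D ∪ -D) : Set G) := by
      rw [← AddSubgroup.closure_toAddSubmonoid]
      rfl
    rw [hcl]
    apply Subset.antisymm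
    · intro x hx
      induction hx using AddSubmonoid.closure_induction_right with
      | zero => exact mem_iUnion.2 ⟨0, rfl⟩
      | add_right x _ y hy ih =>
        obtain ⟨n, hn⟩ := mem_iUnion.1 ih
        exact mem_iUnion.2 ⟨n + 1, (x, y), ⟨hn, hy⟩, rfl⟩
    · refine iUnion_subset fun n => ?_
      induction n with
      | zero =>
        rintro _ rfl
        exact zero_mem (AddSubmonoid.closure (D ∪ -D))
      | succ n ih =>
        rintro _ ⟨⟨x, y⟩, ⟨hx, hy⟩, rfl⟩
        exact add_mem (ih hx) (AddSubmonoid.subset_closure hy)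
  rw [hEq]
  exact .iUnion hW

end MeasureTheory

theorem Cardinal.mk_le_continuum_of_secondCountableTopology (X : Type u) [TopologicalSpace X]
    [T0Space X] [SecondCountableTopology X] : Cardinal.mk X ≤ Cardinal.continuum := by
  let B := TopologicalSpace.countableBasis X
  have hB := TopologicalSpace.isBasis_countableBasis X
  have hinj : Function.Injective fun x : X => {U : B | x ∈ U.1} := by
    intro x y hxy
    refine (hB.inseparable_iff.2 fun U hU => ?_).eq
    exact Set.ext_iff.1 hxy ⟨U, hU⟩
  calc Cardinal.mk X ≤ Cardinal.mk (Set B) := Cardinal.mk_le_of_injective hinj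
    _ = 2 ^ Cardinal.mk B := Cardinal.mk_set
    _ ≤ 2 ^ Cardinal.aleph0 :=
      Cardinal.power_le_power_left two_ne_zero
        (Cardinal.le_aleph0_iff_set_countable.2 (TopologicalSpace.countable_countableBasis X))
    _ = Cardinal.continuum := Cardinal.two_power_aleph0

/-! ### Analyticity and index of the subgroup of singular differences -/

namespace TopDyn

theorem MaxFactor.secondCountableTopology {T : Type v} {X : Type u} [AddCommGroup T]
    [MetricSpace X] [CompactSpace X] [AddAction T X] (x₀ : X) :
    SecondCountableTopology (MaxFactor T x₀) :=
  (MaxFactor.continuous_proj T x₀).secondCountableTopology_of_surjective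
    (MaxFactor.surjective_proj T x₀)

/-- The union over `T` is a union of open sets, so `T` may be uncountable. -/
theorem isGδ_setOf_proximal {T : Type v} {X : Type u} [AddCommGroup T] [MetricSpace X]
    [AddAction T X] [ContinuousConstVAdd T X] : IsGδ {p : X × X | Proximal T p.1 p.2} := by
  have hEq : {p : X × X | Proximal T p.1 p.2} =
      ⋂ n : ℕ, ⋃ t : T, {p | dist (t +ᵥ p.1) (t +ᵥ p.2) < 1 / (n + 1 : ℝ)} := by
    ext ⟨x, y⟩
    have hb : BddBelow (range fun t : T => dist (t +ᵥ x) (t +ᵥ y)) :=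
      ⟨0, by rintro _ ⟨t, rfl⟩; exact dist_nonneg⟩
    simp only [mem_ofPred_eq, mem_iInter, mem_iUnion]
    constructor
    · intro h n
      refine exists_lt_of_ciInf_lt ?_
      rw [h]
      positivity
    · intro h
      refine le_antisymm (le_of_forall_pos_lt_add fun ε hε => ?_)
        (le_ciInf fun t => dist_nonneg)
      obtain ⟨n, hn⟩ := exists_nat_one_div_lt hε
      obtain ⟨t, ht⟩ := h n
      rw [zero_add]
      exact (ciInf_le hb t).trans_lt (ht.trans hn)
  rw [hEq]
  refine .iInter_of_isOpen fun n => isOpen_iUnion fun t => isOpen_lt ?_ continuous_const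
  exact ((continuous_const_vadd t).comp continuous_fst).dist
    ((continuous_const_vadd t).comp continuous_snd)

variable {T : Type v} {X : Type u} [AddCommGroup T] [MetricSpace X] [CompactSpace X]
  [AddAction T X] [ContinuousConstVAdd T X]

/-- The singular points are the continuous image of a Borel set of pairs: distinct, proximal and in
a common fibre. -/
theorem analyticSet_setOf_isSingular (x₀ : X) :
    MeasureTheory.AnalyticSet {ξ | IsSingular T x₀ ξ} := by
  let π := MaxFactor.proj T x₀
  have hπ : Continuous π := MaxFactor.continuous_proj T x₀
  borelize (X × X)
  have hP : MeasurableSet ({p : X × X | π p.1 = π p.2} ∩ {p | p.1 ≠ p.2} ∩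
      {p | Proximal T p.1 p.2}) :=
    ((isClosed_eq (hπ.comp continuous_fst) (hπ.comp continuous_snd)).measurableSet.inter
      (isOpen_ne_fun continuous_fst continuous_snd).measurableSet).inter
      isGδ_setOf_proximal.measurableSet
  convert! hP.analyticSet.image_of_continuous (hπ.comp continuous_fst) using 1
  ext ξ
  constructor
  · rintro ⟨x, y, hx, hy, hne, hxy⟩
    exact ⟨(x, y), ⟨⟨hx.trans hy.symm, hne⟩, hxy⟩, hx⟩
  · rintro ⟨⟨x, y⟩, ⟨⟨heq, hne⟩, hxy⟩, rfl⟩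
    exact ⟨x, y, rfl, heq.symm, hne, hxy⟩

variable [AddAction.IsMinimal T X] (x₀ : X)

theorem analyticSet_singSubgroup :
    MeasureTheory.AnalyticSet (singSubgroup T x₀ : Set (MaxFactor T x₀)) := by
  have := MaxFactor.secondCountableTopology (T := T) x₀
  let _ := TopologicalSpace.metrizableSpaceMetric (MaxFactor T x₀)
  refine MeasureTheory.AnalyticSet.addSubgroup_closure ?_
  have hS := analyticSet_setOf_isSingular (T := T) x₀
  convert! hS.image_prod hS (f := fun p => p.1 - p.2) continuous_sub using 1
  ext ζ
  constructor
  · rintro ⟨ξ, ξ', h, h', rfl⟩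
    exact ⟨(ξ, ξ'), ⟨h, h'⟩, rfl⟩
  · rintro ⟨⟨ξ, ξ'⟩, ⟨h, h'⟩, rfl⟩
    exact ⟨ξ, ξ', h, h', rfl⟩

theorem continuum_le_mk_quotient_singSubgroup
    (ho : ¬ IsOpen (singSubgroup T x₀ : Set (MaxFactor T x₀))) :
    Cardinal.continuum ≤ Cardinal.mk (MaxFactor T x₀ ⧸ singSubgroup T x₀) := by
  have := MaxFactor.secondCountableTopology (T := T) x₀
  exact AddSubgroup.continuum_le_mk_quotient _ (analyticSet_singSubgroup x₀) ho

/-- Between finite index, forced by openness and compactness, and index at least the continuum there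
is nothing. -/
theorem not_isOpen_singSubgroup_iff :
    ¬ IsOpen (singSubgroup T x₀ : Set (MaxFactor T x₀)) ↔
      Uncountable (MaxFactor T x₀ ⧸ singSubgroup T x₀) := by
  constructor
  · intro ho
    rw [← Cardinal.aleph0_lt_mk_iff]
    exact Cardinal.aleph0_lt_continuum.trans_le (continuum_le_mk_quotient_singSubgroup x₀ ho)
  · intro hu ho
    have := AddSubgroup.quotient_finite_of_isOpen _ ho
    exact not_countable (α := MaxFactor T x₀ ⧸ singSubgroup T x₀) inferInstance

/-! ### Elements of the structure group supported over one coset -/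

/-- The coset of `L^sing` over which a point of `X` lies. -/
noncomputable def singCoset (T : Type v) {X : Type u} [AddCommGroup T] [MetricSpace X] [CompactSpace X]
    [AddAction T X] [AddAction.IsMinimal T X] (x₀ x : X) : MaxFactor T x₀ ⧸ singSubgroup T x₀ :=
  (MaxFactor.proj T x₀ x : MaxFactor T x₀ ⧸ singSubgroup T x₀)

/-- If proximality is not transitive, then every structure group contains, for every coset of
`L^sing`, an element acting nontrivially exactly over that coset. -/
theorem exists_mem_structureGroup_supported {e : X → X} (he : IsMinimalIdempotent T X e)
    (hnt : ¬ ∀ x y z : X, Proximal T x y → Proximal T y z → Proximal T x z)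
    (c : MaxFactor T x₀ ⧸ singSubgroup T x₀) :
    ∃ f ∈ structureGroup T e, (∀ x, singCoset T x₀ (f x) = singCoset T x₀ x) ∧
      (∀ x, singCoset T x₀ x ≠ c → f x = e x) ∧ ∃ x, singCoset T x₀ x = c ∧ f x ≠ e x := by
  let π := MaxFactor.proj T x₀
  have heE := he.mem_ellis
  have hee := he.2
  have hmem := fun f : X → X => mem_structureGroup_iff heE hee (f := f)
  have hex : ∃ p ∈ ellis T X, p ∘ p = p ∧ ∃ r ∈ ellis T X, r ∘ r = r ∧ r ∘ e = r ∧
      e ∘ p ∘ r ≠ e := by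
    by_contra! H
    exact hnt fun x y z => proximal_trans_of_forall_idempotent heE hee
      fun p hp hpp r hr hrr hre => H p hp hpp r hr hrr hre
  obtain ⟨p, hp, hpp, r, hr, hrr, hre, hne⟩ := hex
  -- `k` induces the identity on `MaxFactor` and agrees with `e` off the singular fibres, so it is
  -- nontrivial only over the coset of `π w`.
  set k : X → X := e ∘ p ∘ r with hk
  have hkG : k ∈ structureGroup T e := by
    refine ⟨p ∘ r, comp_mem_ellis hp hr, ?_⟩
    rw [Function.comp_assoc, hre]
  obtain ⟨hkE, hk1, hk2⟩ := (hmem k).1 hkG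
  have hkπ : ∀ x, π (k x) = π x := by
    intro x
    simp only [hk, Function.comp_apply, π]
    rw [proj_apply_of_idempotent x₀ heE hee, proj_apply_of_idempotent x₀ hp hpp,
      proj_apply_of_idempotent x₀ hr hrr]
  have hkreg : ∀ x, ¬ IsSingular T x₀ (π x) → k x = e x := by
    intro x hx
    simp only [hk, Function.comp_apply]
    rw [apply_eq_self_of_not_isSingular x₀ hr hrr hx, apply_eq_self_of_not_isSingular x₀ hp hpp hx]
  obtain ⟨w, hw⟩ := Function.ne_iff.1 hne
  have hws : IsSingular T x₀ (π w) := by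
    by_contra h
    exact hw (hkreg w h)
  obtain ⟨γ, rfl⟩ := QuotientAddGroup.mk_surjective c
  -- Translation by `π w - γ` carries `γ` to `π w`, so the conjugate `g' ∘ k ∘ g` is supported over
  -- the coset of `γ`.
  obtain ⟨g, hg, hgπ⟩ := exists_mem_structureGroup_proj_eq x₀ heE hee (π w - γ)
  obtain ⟨g', hg', hg'g, hgg'⟩ := he.exists_inverse hg
  have hg'g : ∀ x, g' (g x) = e x := congrFun hg'g
  have hgg' : ∀ x, g (g' x) = e x := congrFun hgg'
  have hg1 := ((hmem g).1 hg).2.1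
  obtain ⟨d, hd⟩ := exists_proj_apply_eq_add x₀ ((hmem g').1 hg').1
  have hfπ : ∀ x, π (g' (k (g x))) = π x := by
    intro x
    have h1 : π (g' (g x)) = π x := by
      rw [hg'g]
      exact proj_apply_of_idempotent x₀ heE hee x
    rw [← h1]
    change MaxFactor.proj T x₀ (g' (k (g x))) = MaxFactor.proj T x₀ (g' (g x))
    rw [hd, hd]
    exact congrArg (· + d) (hkπ (g x))
  have hsupp : ∀ x, g' (k (g x)) ≠ e x → singCoset T x₀ x = (γ : MaxFactor T x₀ ⧸ _) := by
    intro x hx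
    have hs : IsSingular T x₀ (π (g x)) := by
      by_contra h
      apply hx
      rw [hkreg _ h, hg1, hg'g]
    have hL : π w - π (g x) ∈ singSubgroup T x₀ :=
      AddSubgroup.subset_closure ⟨_, _, hws, hs, rfl⟩
    refine QuotientAddGroup.eq.2 ?_
    have h2 : π (g x) = π x + (π w - γ) := hgπ x
    have h3 : -π x + γ = π w - π (g x) := by
      rw [h2]
      abel
    change -π x + γ ∈ singSubgroup T x₀
    rwa [h3]
  refine ⟨g' ∘ k ∘ g, comp_mem_structureGroup heE hee hg' (comp_mem_structureGroup heE hee hkG hg),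
    fun x => congrArg QuotientAddGroup.mk (hfπ x), fun x hx => ?_, ?_⟩
  · by_contra h
    exact hx (hsupp x h)
  · have hx : g' (k (g (g' w))) ≠ e (g' w) := by
      intro h
      apply hw
      have h1 := congrArg g h
      rwa [hgg', hgg', hk1, hk2, show g (e (g' w)) = e w by
        rw [((hmem g').1 hg').2.1, hgg']] at h1
    exact ⟨g' w, hsupp _ hx, hx⟩

/-- Elements of a structure group supported over distinct cosets of `L^sing` can be combined
freely. -/
theorem glue_mem_structureGroup {e : X → X} (he : IsMinimalIdempotent T X e)
    {f : MaxFactor T x₀ ⧸ singSubgroup T x₀ → X → X} (hf : ∀ c, f c ∈ structureGroup T e)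
    (hcoset : ∀ c x, singCoset T x₀ (f c x) = singCoset T x₀ x)
    (hsupp : ∀ c x, singCoset T x₀ x ≠ c → f c x = e x)
    (A : Set (MaxFactor T x₀ ⧸ singSubgroup T x₀)) [DecidablePred (· ∈ A)] :
    (fun x => if singCoset T x₀ x ∈ A then f (singCoset T x₀ x) x else e x) ∈
      structureGroup T e := by
  classical
  have heE := he.mem_ellis
  have hee := he.2
  have hee' : ∀ x, e (e x) = e x := congrFun hee
  have hmem := fun f : X → X => mem_structureGroup_iff heE hee (f := f)
  have h1 : ∀ c x, e (f c x) = f c x := fun c => ((hmem _).1 (hf c)).2.1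
  have h2 : ∀ c x, f c (e x) = f c x := fun c => ((hmem _).1 (hf c)).2.2
  have he_coset : ∀ x, singCoset T x₀ (e x) = singCoset T x₀ x := fun x =>
    congrArg QuotientAddGroup.mk (proj_apply_of_idempotent x₀ heE hee x)
  -- For finitely many cosets the glued map is the product of the `f c`: each factor preserves
  -- cosets and acts as `e` off its own.
  have hfin : ∀ F : Finset (MaxFactor T x₀ ⧸ singSubgroup T x₀),
      (fun x => if singCoset T x₀ x ∈ F then f (singCoset T x₀ x) x else e x) ∈
        structureGroup T e := by
    intro F
    induction F using Finset.induction_on with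
    | empty => exact ⟨e, heE, by simp [hee]⟩
    | insert c F hc ih =>
      convert! comp_mem_structureGroup heE hee (hf c) ih using 1
      ext x
      simp only [Function.comp_apply, Finset.mem_insert]
      by_cases hxc : singCoset T x₀ x = c
      · simp [hxc, hc, h2]
      · by_cases hxF : singCoset T x₀ x ∈ F
        · rw [if_pos (Or.inr hxF), if_pos hxF, hsupp c _ (by rwa [hcoset]), h1]
        · rw [if_neg (by tauto), if_neg hxF, h2, hsupp c _ hxc]
  refine (hmem _).2 ⟨mem_ellis_of_forall_finset fun s => ?_, fun x => ?_, fun x => ?_⟩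
  · refine ⟨_, ((hmem _).1 (hfin ((s.image (singCoset T x₀)).filter (· ∈ A)))).1, fun x hx => ?_⟩
    have : singCoset T x₀ x ∈ (s.image (singCoset T x₀)).filter (· ∈ A) ↔
        singCoset T x₀ x ∈ A := by
      rw [Finset.mem_filter]
      exact and_iff_right (Finset.mem_image_of_mem _ hx)
    simp only [this]
  · split_ifs
    · exact h1 _ _
    · exact hee' x
  · simp only [he_coset, h2, hee']

theorem mk_structureGroup_eq {e : X → X} (he : IsMinimalIdempotent T X e)
    (hnt : ¬ ∀ x y z : X, Proximal T x y → Proximal T y z → Proximal T x z)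
    (ho : ¬ IsOpen (singSubgroup T x₀ : Set (MaxFactor T x₀))) :
    Cardinal.mk (structureGroup T e) = 2 ^ Cardinal.continuum := by
  classical
  apply le_antisymm
  · calc Cardinal.mk (structureGroup T e) ≤ Cardinal.mk (X → X) := Cardinal.mk_set_le _
      _ = Cardinal.mk X ^ Cardinal.mk X := (Cardinal.power_def X X).symm
      _ ≤ Cardinal.continuum ^ Cardinal.continuum := by
        have hX := Cardinal.mk_le_continuum_of_secondCountableTopology X
        have : Nonempty X := ⟨x₀⟩
        exact (Cardinal.power_le_power_right hX).trans
          (Cardinal.power_le_power_left Cardinal.continuum_ne_zero hX)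
      _ = 2 ^ Cardinal.continuum := Cardinal.power_self_eq Cardinal.aleph0_le_continuum
  · choose f hf hcoset hsupp hne using exists_mem_structureGroup_supported x₀ he hnt
    let Φ : Set (MaxFactor T x₀ ⧸ singSubgroup T x₀) → structureGroup T e := fun A =>
      ⟨_, glue_mem_structureGroup x₀ he hf hcoset hsupp A⟩
    -- `A` is recovered from `Φ A` as the set of cosets over which it differs from `e`.
    have hΦ : Function.Injective Φ := by
      intro A B hAB
      ext c
      obtain ⟨x, rfl, hx⟩ := hne c
      have h := congrFun (congrArg Subtype.val hAB) x
      simp only [Φ] at h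
      by_cases hA : singCoset T x₀ x ∈ A <;> by_cases hB : singCoset T x₀ x ∈ B
      · simp [hA, hB]
      · rw [if_pos hA, if_neg hB] at h
        exact absurd h hx
      · rw [if_neg hA, if_pos hB] at h
        exact absurd h.symm hx
      · simp [hA, hB]
    calc (2 : Cardinal) ^ Cardinal.continuum
        ≤ 2 ^ Cardinal.mk (MaxFactor T x₀ ⧸ singSubgroup T x₀) :=
          Cardinal.power_le_power_left two_ne_zero (continuum_le_mk_quotient_singSubgroup x₀ ho)
      _ = Cardinal.mk (Set (MaxFactor T x₀ ⧸ singSubgroup T x₀)) := Cardinal.mk_set.symm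
      _ ≤ Cardinal.mk (structureGroup T e) := Cardinal.mk_le_of_injective hΦ

end TopDyn

theorem theorem2 {T : Type v} {X : Type u} [AddCommGroup T] [MetricSpace X] [CompactSpace X]
    [AddAction T X] [ContinuousConstVAdd T X] [AddAction.IsMinimal T X] (x₀ : X) :
    (¬ IsOpen (TopDyn.singSubgroup T x₀ : Set (TopDyn.MaxFactor T x₀)) ↔
      Uncountable (TopDyn.MaxFactor T x₀ ⧸ TopDyn.singSubgroup T x₀)) ∧
    ((¬ ∀ x y z : X, TopDyn.Proximal T x y → TopDyn.Proximal T y z → TopDyn.Proximal T x z) →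
      ¬ IsOpen (TopDyn.singSubgroup T x₀ : Set (TopDyn.MaxFactor T x₀)) →
      ∀ e : X → X, TopDyn.IsMinimalIdempotent T X e →
        Cardinal.mk (TopDyn.structureGroup T e) = 2 ^ Cardinal.continuum) :=
  ⟨TopDyn.not_isOpen_singSubgroup_iff x₀, fun hnt ho _ he =>
    TopDyn.mk_structureGroup_eq x₀ he hnt ho⟩
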